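/- For $\alpha\in(0,2]$ and $c>0$ let $$G_{\alpha,c}(x)=\frac1{2\pi}\sum_{n\in\mathbb Z}\frac{\cos(nx)}{c+|n|^\alpha},\qquad x\in(0,\pi),$$ where the series is the limit as $N\to\infty$ of the partial sums over $|n|\le N$. Then: 1. The series converges for every $x\in(0,\pi)$, the function $G_{\alpha,c}$ is differentiable on $(0,\pi)$, and $G_{\alpha,c}'(\pi-)=\lim_{x\uparrow\pi}G_{\alpha,c}'(x)=0$. 2. There is no positive Radon measure $\mu$ on $[0,\infty)$ such that $G_{\alpha,c}(x)=\int_{[0,\infty)}e^{-xt}\,d\mu(t)$ (with a convergent integral) for all $x\in(0,\pi)$. 3. $G_{\alpha,c}$ cannot be extended to a completely monotone function on $(0,\infty)$: there is no function $F:(0,\infty)\to\mathbb R$ of class $C^\infty$ with $(-1)^pF^{(p)}\ge 0$ on $(0,\infty)$ for every integer $p\ge0$ and $F=G_{\alpha,c}$ on $(0,\pi)$. -/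

import Mathlib

open scoped ContDiff NNReal Topology

noncomputable section

/-- The `n`-th term `cos (n x) / (c + |n|^α)`, `n ∈ ℤ`, of the trigonometric series of the Green
function of the periodic operator `c + (-Δ)^(α/2)`. -/
def periodicGreenTerm (α c x : ℝ) (n : ℤ) : ℝ :=
  Real.cos (n * x) / (c + |(n : ℝ)| ^ α)

/-- The Green function `G_{α,c}(x) = (1 / 2π) ∑_{n ∈ ℤ} cos (n x) / (c + |n|^α)`. The series is the
limit of the symmetric partial sums over `-N ≤ n ≤ N`: for `α ≤ 1` it converges on `(0, π)`, but not
absolutely. -/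
def periodicGreen (α c x : ℝ) : ℝ :=
  1 / (2 * Real.pi) * ∑'[SummationFilter.symmetricIcc ℤ] n : ℤ, periodicGreenTerm α c x n

/-- A function is completely monotone on (an open interval) `s` if it is smooth on `s` and
`(-1)^p f^(p) ≥ 0` on `s` for every `p ≥ 0`. -/
def CompletelyMonotoneOn (f : ℝ → ℝ) (s : Set ℝ) : Prop :=
  ContDiffOn ℝ ∞ f s ∧ ∀ p : ℕ, ∀ x ∈ s, 0 ≤ (-1 : ℝ) ^ p * iteratedDerivWithin p f s x

end

open MeasureTheory ProbabilityTheory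

/-! The series is symmetric about `π`, so its derivative vanishes there; a completely monotone
function with a critical point is constant, and `G` is not constant.

Rigidity: if `F` is completely monotone and `F' b = 0`, then `-F'` is nonnegative and nonincreasing,
hence zero beyond `b`. Iterating `nat_mul_le_sub_mul_of_completelyMonotone` carries the vanishing
back to all of `(0, ∞)`, without Bernstein's theorem or analyticity.

Regularity: multiplying the series by `2 - 2 cos x` replaces its coefficients by second differences,
of size `O(n^(-α-2))`, so the new series can be differentiated termwise even when the original one
converges only conditionally.

Nonconstancy: if `G` were constant, orthogonality of cosines would kill the second differences from
index 1 on, and a null sequence with eventually constant first differences cannot be strictly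
decreasing.

A representing measure would give a completely monotone extension, so the second claim follows from
the third. -/

/-! ### Rigidity of completely monotone functions. -/

/-- If `h (p + 1) = -(h p)'`, all `h p` are nonnegative, and all `h q` with `q ≥ p` vanish at `b`,
then `n * h p x ≤ (b - x) * h (p + 1) x` to the left of `b`, for every `n`. -/
theorem nat_mul_le_sub_mul_of_completelyMonotone {h : ℕ → ℝ → ℝ} {b : ℝ}
    (hd : ∀ p, ∀ x > 0, HasDerivAt (h p) (-h (p + 1) x) x) (hn : ∀ p, ∀ x > 0, 0 ≤ h p x)
    (n : ℕ) (p : ℕ) (hb : ∀ q ≥ p, h q b = 0) {x : ℝ} (hx : 0 < x) (hxb : x ≤ b) :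
    n * h p x ≤ (b - x) * h (p + 1) x := by
  induction n generalizing p x with
  | zero =>
    have := mul_nonneg (sub_nonneg.2 hxb) (hn (p + 1) x hx)
    simpa using this
  | succ n ih =>
    have hφ : ∀ y > 0, HasDerivAt (fun y => (b - y) * h (p + 1) y - (n + 1) * h p y)
        (n * h (p + 1) y - (b - y) * h (p + 2) y) y := fun y hy => by
      have := (((hasDerivAt_id y).const_sub b).mul (hd (p + 1) y hy)).sub
        ((hd p y hy).const_mul ((n : ℝ) + 1))
      exact this.congr_deriv (by simp only [id]; ring)
    -- The induction hypothesis at `p + 1` says exactly that this derivative is nonpositive; the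
    -- function vanishes at `b`, so it is nonnegative before `b`.
    have hanti : AntitoneOn (fun y => (b - y) * h (p + 1) y - (n + 1) * h p y) (Set.Icc x b) := by
      refine antitoneOn_of_hasDerivWithinAt_nonpos (convex_Icc x b)
        (fun y hy => (hφ y (hx.trans_le hy.1)).continuousAt.continuousWithinAt)
        (fun y hy => (hφ y ?_).hasDerivWithinAt) (fun y hy => ?_)
      · exact hx.trans_le (interior_subset hy).1
      · have hy := interior_subset hy
        exact sub_nonpos.2 (ih (p + 1) (fun q hq => hb q (by omega)) (hx.trans_le hy.1) hy.2)
    have := hanti (Set.left_mem_Icc.2 hxb) (Set.right_mem_Icc.2 hxb) hxb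
    simp only [hb p le_rfl, sub_self, zero_mul, mul_zero] at this
    push_cast
    linarith

/-- If all signed derivatives of a function are nonnegative on `(0, ∞)` and the first one vanishes
at a point, then it vanishes everywhere. -/
theorem eq_zero_of_completelyMonotone {h : ℕ → ℝ → ℝ} {b : ℝ} (hb : 0 < b)
    (hd : ∀ p, ∀ x > 0, HasDerivAt (h p) (-h (p + 1) x) x) (hn : ∀ p, ∀ x > 0, 0 ≤ h p x)
    (h1 : h 1 b = 0) {x : ℝ} (hx : 0 < x) : h 1 x = 0 := by
  have hanti : AntitoneOn (h 1) (Set.Ioi 0) := by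
    refine antitoneOn_of_hasDerivWithinAt_nonpos (convex_Ioi 0)
      (fun y hy => (hd 1 y hy).continuousAt.continuousWithinAt)
      (fun y hy => (hd 1 y (interior_subset hy)).hasDerivWithinAt)
      (fun y hy => neg_nonpos.2 (hn 2 y (interior_subset hy)))
  have hzero : ∀ p, ∀ y > b, h (p + 1) y = 0 := by
    intro p
    induction p with
    | zero =>
      intro y hy
      have := hanti (Set.mem_Ioi.2 hb) (Set.mem_Ioi.2 (hb.trans hy)) hy.le
      exact le_antisymm (by simpa [h1] using this) (hn _ y (hb.trans hy))
    | succ p ih =>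
      intro y hy
      have h0 : HasDerivAt (h (p + 1)) 0 y :=
        (hasDerivAt_const y (0 : ℝ)).congr_of_eventuallyEq
          (Filter.eventually_of_mem (Ioi_mem_nhds hy) ih)
      simpa using (hd (p + 1) y (hb.trans hy)).unique h0
  rcases lt_or_ge b x with hbx | hbx
  · exact hzero 0 x hbx
  -- The base point is `b + 1` because the higher derivatives are known to vanish only strictly
  -- beyond `b`. Since `n` is arbitrary, `h 1 x` must be zero.
  have key (n : ℕ) := nat_mul_le_sub_mul_of_completelyMonotone (b := b + 1) hd hn n 1
    (fun q hq => by obtain ⟨r, rfl⟩ := Nat.exists_eq_add_of_le' hq; exact hzero r _ (by linarith))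
    hx (by linarith)
  by_contra hne
  have hpos : 0 < h 1 x := lt_of_le_of_ne (hn 1 x hx) (Ne.symm hne)
  obtain ⟨n, hn'⟩ := exists_nat_gt ((b + 1 - x) * h 2 x / h 1 x)
  rw [div_lt_iff₀ hpos] at hn'
  exact absurd (key n) (not_le.2 hn')

/-- The signed derivatives of a completely monotone function form a chain of derivatives. -/
theorem CompletelyMonotoneOn.hasDerivAt_signed {F : ℝ → ℝ}
    (hF : CompletelyMonotoneOn F (Set.Ioi 0)) (p : ℕ) {x : ℝ} (hx : 0 < x) :
    HasDerivAt (fun y => (-1 : ℝ) ^ p * iteratedDerivWithin p F (Set.Ioi 0) y)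
      (-((-1 : ℝ) ^ (p + 1) * iteratedDerivWithin (p + 1) F (Set.Ioi 0) x)) x := by
  have hdiff := (hF.1.differentiableOn_iteratedDerivWithin (m := p)
    (by exact_mod_cast ENat.natCast_lt_top p) (uniqueDiffOn_Ioi 0)) x hx
  have := (hdiff.hasDerivWithinAt.hasDerivAt (Ioi_mem_nhds hx)).const_mul ((-1 : ℝ) ^ p)
  exact this.congr_deriv (by rw [iteratedDerivWithin_succ]; ring)

/-- A completely monotone function on `(0, ∞)` whose derivative tends to `0` from the left at a
point is constant. -/
theorem CompletelyMonotoneOn.eq_of_tendsto_deriv {F : ℝ → ℝ} {b : ℝ}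
    (hF : CompletelyMonotoneOn F (Set.Ioi 0)) (hb : 0 < b)
    (hlim : Filter.Tendsto (deriv F) (𝓝[<] b) (𝓝 0)) {x y : ℝ} (hx : 0 < x) (hy : 0 < y) :
    F x = F y := by
  set h : ℕ → ℝ → ℝ := fun p y => (-1 : ℝ) ^ p * iteratedDerivWithin p F (Set.Ioi 0) y with hdef
  have hd : ∀ p, ∀ x > 0, HasDerivAt (h p) (-h (p + 1) x) x :=
    fun p x hx => hF.hasDerivAt_signed p hx
  have h0 : h 0 = F := by ext; simp [hdef]
  have hderiv : ∀ x > 0, deriv F x = -h 1 x := fun x hx => by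
    have := hd 0 x hx
    rw [h0] at this
    exact this.deriv
  have h1 : h 1 b = 0 := by
    have hc : Filter.Tendsto (fun x => -h 1 x) (𝓝[<] b) (𝓝 (-h 1 b)) :=
      ((hd 1 b hb).continuousAt.neg.tendsto).mono_left nhdsWithin_le_nhds
    have hev : deriv F =ᶠ[𝓝[<] b] fun x => -h 1 x :=
      Filter.eventually_of_mem (mem_nhdsWithin_of_mem_nhds (Ioi_mem_nhds hb)) hderiv
    have := tendsto_nhds_unique (hlim.congr' hev) hc
    linarith
  have hzero : ∀ x > 0, HasDerivAt F 0 x := fun x hx => by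
    have := hd 0 x hx
    rwa [h0, eq_zero_of_completelyMonotone hb hd hF.2 h1 hx, neg_zero] at this
  exact (convex_Ioi (0 : ℝ)).is_const_of_fderivWithin_eq_zero
    (fun z hz => (hzero z hz).differentiableAt.differentiableWithinAt)
    (fun z hz => by
      rw [fderivWithin_of_isOpen isOpen_Ioi hz]
      exact (hasDerivAt_iff_hasFDerivAt.1 (hzero z hz)).fderiv.trans (by ext; simp)) hx hy

/-- The Laplace transform of a positive measure is completely monotone. -/
theorem completelyMonotoneOn_laplace (μ : Measure ℝ≥0)
    (hμ : ∀ x > 0, Integrable (fun t : ℝ≥0 => Real.exp (-(x * (t : ℝ)))) μ) :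
    CompletelyMonotoneOn (fun x => ∫ t : ℝ≥0, Real.exp (-(x * (t : ℝ))) ∂μ) (Set.Ioi 0) := by
  have hmgf : (fun x => ∫ t : ℝ≥0, Real.exp (-(x * (t : ℝ))) ∂μ)
      = mgf (fun t : ℝ≥0 => -(t : ℝ)) μ := by
    ext x
    simp [mgf]
  have hint : Set.Ioi 0 ⊆ interior (integrableExpSet (fun t : ℝ≥0 => -(t : ℝ)) μ) :=
    interior_maximal (fun x hx => by simpa [integrableExpSet] using hμ x hx) isOpen_Ioi
  rw [hmgf]
  refine ⟨fun x hx => (analyticAt_mgf (hint hx)).contDiffAt.contDiffWithinAt, fun p x hx => ?_⟩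
  rw [iteratedDerivWithin_of_isOpen isOpen_Ioi hx, iteratedDeriv_mgf (hint hx),
    ← integral_const_mul]
  refine integral_nonneg fun t => ?_
  simp only [Pi.zero_apply]
  rw [← mul_assoc, ← mul_pow]
  simp only [neg_mul, one_mul, neg_neg]
  positivity

/-! ### Cosine series through second differences. -/

/-- The negative of the second difference of `a`, centred at `n + 1`. -/
noncomputable def negSecondDiff (a : ℕ → ℝ) (n : ℕ) : ℝ := 2 * a (n + 1) - a n - a (n + 2)

/-- The cosine series with coefficients the second differences of `a`, reflected at `0`. It is
`(2 - 2 cos x)` times the cosine series with coefficients `a`. -/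
noncomputable def secondDiffSeries (a : ℕ → ℝ) (x : ℝ) : ℝ :=
  2 * (a 0 - a 1) + 2 * ∑' n, negSecondDiff a n * Real.cos ((n + 1) * x)

/-- Summation by parts twice, from `2 cos x cos (kx) = cos ((k-1)x) + cos ((k+1)x)`. The last
summand is the boundary term, which tends to zero when `a` does. -/
theorem two_sub_two_cos_mul_sum (a : ℕ → ℝ) (x : ℝ) (N : ℕ) :
    (2 - 2 * Real.cos x) * (a 0 + 2 * ∑ n ∈ Finset.range N, a (n + 1) * Real.cos ((n + 1) * x)) =
      2 * (a 0 - a 1) + 2 * ∑ n ∈ Finset.range N, negSecondDiff a n * Real.cos ((n + 1) * x) +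
        2 * (a (N + 1) * Real.cos (N * x) - a N * Real.cos ((N + 1) * x)) := by
  induction N with
  | zero => simp; ring
  | succ N ih =>
    have h : 2 * Real.cos x * Real.cos ((N + 1) * x) =
        Real.cos (N * x) + Real.cos ((N + 1 + 1) * x) := by
      have h1 : (N : ℝ) * x = (N + 1) * x - x := by ring
      have h2 : ((N : ℝ) + 1 + 1) * x = (N + 1) * x + x := by ring
      rw [h1, h2, Real.cos_add, Real.cos_sub]
      ring
    rw [Finset.sum_range_succ, Finset.sum_range_succ, mul_add 2, ← add_assoc, mul_add, ih]
    push_cast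
    simp only [negSecondDiff]
    linear_combination (-2 * a (N + 1)) * h

section
variable {a : ℕ → ℝ}

theorem summable_negSecondDiff_mul_cos (hs : Summable fun n : ℕ => (n + 1) * |negSecondDiff a n|)
    (f : ℕ → ℝ) (hf : ∀ n, |f n| ≤ 1) : Summable fun n : ℕ => negSecondDiff a n * f n := by
  refine hs.of_norm_bounded fun n => ?_
  rw [Real.norm_eq_abs, abs_mul]
  calc |negSecondDiff a n| * |f n| ≤ |negSecondDiff a n| * 1 := by gcongr; exact hf n
    _ ≤ (n + 1) * |negSecondDiff a n| := by nlinarith [abs_nonneg (negSecondDiff a n),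
        (Nat.cast_nonneg n : (0 : ℝ) ≤ n)]

theorem tendsto_cosSum (ha : Filter.Tendsto a Filter.atTop (𝓝 0))
    (hs : Summable fun n : ℕ => (n + 1) * |negSecondDiff a n|) {x : ℝ} (hx : Real.cos x ≠ 1) :
    Filter.Tendsto
      (fun N : ℕ => a 0 + 2 * ∑ n ∈ Finset.range N, a (n + 1) * Real.cos ((n + 1) * x))
      Filter.atTop (𝓝 (secondDiffSeries a x / (2 - 2 * Real.cos x))) := by
  have hne : 2 - 2 * Real.cos x ≠ 0 := fun h => hx (by linarith)
  have hbdd : ∀ (u : ℕ → ℝ) (t : ℕ → ℝ), Filter.Tendsto u Filter.atTop (𝓝 0) →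
      Filter.Tendsto (fun N => u N * Real.cos (t N)) Filter.atTop (𝓝 0) := fun u t hu => by
    refine squeeze_zero_norm (fun N => ?_) (tendsto_zero_iff_norm_tendsto_zero.1 hu)
    rw [norm_mul]
    exact mul_le_of_le_one_right (norm_nonneg _) (Real.abs_cos_le_one _)
  have hlim := (((summable_negSecondDiff_mul_cos hs (fun n => Real.cos ((n + 1) * x))
    fun n => Real.abs_cos_le_one _).hasSum.tendsto_sum_nat.const_mul 2).const_add
    (2 * (a 0 - a 1))).add (((hbdd (fun N => a (N + 1)) (fun N => N * x)
      ((Filter.tendsto_add_atTop_iff_nat 1).2 ha)).sub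
      (hbdd a (fun N => (N + 1) * x) ha)).const_mul 2)
  simp only [← two_sub_two_cos_mul_sum, sub_zero, mul_zero, add_zero] at hlim
  refine (hlim.div_const (2 - 2 * Real.cos x)).congr fun N => ?_
  rw [mul_div_cancel_left₀ _ hne]

/-- The weight `n + 1` in `hs` pays for the factor produced by differentiating each cosine. -/
theorem hasDerivAt_secondDiffSeries (hs : Summable fun n : ℕ => (n + 1) * |negSecondDiff a n|)
    (x : ℝ) : HasDerivAt (secondDiffSeries a)
      (2 * ∑' n : ℕ, negSecondDiff a n * (-Real.sin ((n + 1) * x) * (n + 1))) x := by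
  refine HasDerivAt.const_add _ (HasDerivAt.const_mul 2 ?_)
  refine hasDerivAt_tsum (g := fun n y => negSecondDiff a n * Real.cos ((n + 1) * y))
    (g' := fun n y => negSecondDiff a n * (-Real.sin ((n + 1) * y) * (n + 1))) (y₀ := 0) hs
    (fun n y => ?_) (fun n y => ?_)
    (summable_negSecondDiff_mul_cos hs _ fun n => Real.abs_cos_le_one _) x
  · have h := ((hasDerivAt_id y).const_mul ((n : ℝ) + 1)).cos.const_mul (negSecondDiff a n)
    simpa using h
  · rw [norm_mul, norm_mul, norm_neg, Real.norm_eq_abs, Real.norm_eq_abs, Real.norm_eq_abs,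
      abs_of_nonneg (by positivity : (0 : ℝ) ≤ n + 1)]
    have := Real.abs_sin_le_one ((n + 1) * y)
    have h2 : |Real.sin ((n + 1) * y)| * ((n : ℝ) + 1) ≤ 1 * (n + 1) := by gcongr
    calc _ ≤ |negSecondDiff a n| * (1 * (n + 1)) := by gcongr
      _ = _ := by ring

theorem continuous_deriv_secondDiffSeries
    (hs : Summable fun n : ℕ => (n + 1) * |negSecondDiff a n|) :
    Continuous fun x : ℝ =>
      2 * ∑' n : ℕ, negSecondDiff a n * (-Real.sin ((n + 1) * x) * (n + 1)) := by
  refine continuous_const.mul (continuous_tsum (fun n => by fun_prop) hs fun n y => ?_)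
  rw [norm_mul, norm_mul, norm_neg, Real.norm_eq_abs, Real.norm_eq_abs, Real.norm_eq_abs,
    abs_of_nonneg (by positivity : (0 : ℝ) ≤ n + 1)]
  have := Real.abs_sin_le_one ((n + 1) * y)
  have h2 : |Real.sin ((n + 1) * y)| * ((n : ℝ) + 1) ≤ 1 * (n + 1) := by gcongr
  calc _ ≤ |negSecondDiff a n| * (1 * (n + 1)) := by gcongr
    _ = _ := by ring

theorem hasDerivAt_secondDiffSeries_div
    (hs : Summable fun n : ℕ => (n + 1) * |negSecondDiff a n|) {x : ℝ} (hx : Real.cos x ≠ 1) :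
    HasDerivAt (fun x => secondDiffSeries a x / (2 - 2 * Real.cos x))
      (((2 * ∑' n : ℕ, negSecondDiff a n * (-Real.sin ((n + 1) * x) * (n + 1))) *
        (2 - 2 * Real.cos x) - secondDiffSeries a x * (2 * Real.sin x)) /
          (2 - 2 * Real.cos x) ^ 2) x := by
  have hne : 2 - 2 * Real.cos x ≠ 0 := fun h => hx (by linarith)
  have hden : HasDerivAt (fun x => 2 - 2 * Real.cos x) (2 * Real.sin x) x := by
    simpa using ((Real.hasDerivAt_cos x).const_mul 2).const_sub 2
  exact (hasDerivAt_secondDiffSeries hs x).div hden hne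

/-- The derivative of the cosine series vanishes at `π`. -/
theorem tendsto_deriv_secondDiffSeries_div
    (hs : Summable fun n : ℕ => (n + 1) * |negSecondDiff a n|) :
    Filter.Tendsto (deriv fun x => secondDiffSeries a x / (2 - 2 * Real.cos x))
      (𝓝 Real.pi) (𝓝 0) := by
  have hev : ∀ᶠ x in 𝓝 Real.pi, Real.cos x ≠ 1 :=
    Real.continuous_cos.continuousAt.eventually_ne (by norm_num)
  have hB : Continuous (secondDiffSeries a) :=
    continuous_iff_continuousAt.2 fun x => (hasDerivAt_secondDiffSeries hs x).continuousAt
  have hcont : ContinuousAt (fun x : ℝ =>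
      (((2 * ∑' n : ℕ, negSecondDiff a n * (-Real.sin ((n + 1) * x) * (n + 1))) *
        (2 - 2 * Real.cos x) - secondDiffSeries a x * (2 * Real.sin x)) /
          (2 - 2 * Real.cos x) ^ 2)) Real.pi := by
    refine ContinuousAt.div ?_ (by fun_prop) (by norm_num)
    exact (((continuous_deriv_secondDiffSeries hs).mul (by fun_prop)).sub
      (hB.mul (by fun_prop))).continuousAt
  have hsin : ∀ n : ℕ, Real.sin (((n : ℝ) + 1) * Real.pi) = 0 := fun n => by
    exact_mod_cast Real.sin_nat_mul_pi (n + 1)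
  have h := hcont.tendsto
  simp only [hsin, Real.sin_pi, neg_zero, zero_mul, mul_zero, tsum_zero, sub_self, zero_div] at h
  exact h.congr' (hev.mono fun x hx => (hasDerivAt_secondDiffSeries_div hs hx).deriv.symm)

end

/-! ### Nonconstancy by orthogonality of cosines. -/

theorem integral_cos_int_mul (k : ℤ) (hk : k ≠ 0) :
    ∫ x in (0 : ℝ)..Real.pi, Real.cos (k * x) = 0 := by
  have hk' : (k : ℝ) ≠ 0 := by exact_mod_cast hk
  rw [intervalIntegral.integral_comp_mul_left (fun x => Real.cos x) hk', integral_cos]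
  simp [Real.sin_int_mul_pi]

theorem integral_cos_mul_cos (p q : ℕ) (hpq : p ≠ q) :
    ∫ x in (0 : ℝ)..Real.pi, Real.cos (p * x) * Real.cos (q * x) = 0 := by
  have h : ∀ x : ℝ, Real.cos (p * x) * Real.cos (q * x) =
      (Real.cos (((p - q : ℤ) : ℝ) * x) + Real.cos (((p + q : ℤ) : ℝ) * x)) / 2 := fun x => by
    push_cast
    rw [sub_mul, add_mul, Real.cos_add, Real.cos_sub]
    ring
  simp_rw [h]
  rw [intervalIntegral.integral_div, intervalIntegral.integral_add
    (Continuous.intervalIntegrable (by fun_prop) _ _)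
    (Continuous.intervalIntegrable (by fun_prop) _ _),
    integral_cos_int_mul _ (by omega), integral_cos_int_mul _ (by omega)]
  simp

theorem integral_cos_sq_pos (p : ℕ) :
    0 < ∫ x in (0 : ℝ)..Real.pi, Real.cos (p * x) * Real.cos (p * x) := by
  refine intervalIntegral.integral_pos Real.pi_pos (Continuous.continuousOn (by fun_prop))
    (fun x _ => mul_self_nonneg _) ⟨0, Set.left_mem_Icc.2 Real.pi_pos.le, by simp⟩

/-- A cosine series with absolutely summable coefficients that agrees on `(0, π)` with a
combination of `1` and `cos x` has vanishing coefficients from `cos (2 x)` on. -/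
theorem coeff_eq_zero_of_tsum_cos_eq {b : ℕ → ℝ} (hb : Summable b) {A D : ℝ}
    (h : ∀ x ∈ Set.Ioo 0 Real.pi, ∑' n : ℕ, b n * Real.cos ((n + 1) * x) = A + D * Real.cos x)
    (m : ℕ) : b (m + 1) = 0 := by
  have hsum : HasSum (fun n : ℕ => ∫ x in (0 : ℝ)..Real.pi,
      b n * (Real.cos (((n + 1 : ℕ) : ℝ) * x) * Real.cos (((m + 2 : ℕ) : ℝ) * x)))
      (∫ x in (0 : ℝ)..Real.pi, (A + D * Real.cos x) * Real.cos (((m + 2 : ℕ) : ℝ) * x)) := by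
    refine intervalIntegral.hasSum_integral_of_dominated_convergence (fun n _ => |b n|)
      (fun n => Continuous.aestronglyMeasurable (by fun_prop))
      (fun n => .of_forall fun x _ => ?_) (.of_forall fun x _ => hb.abs)
      intervalIntegrable_const ?_
    · rw [norm_mul, norm_mul]
      exact mul_le_of_le_one_right (abs_nonneg _)
        (mul_le_one₀ (Real.abs_cos_le_one _) (abs_nonneg _) (Real.abs_cos_le_one _))
    -- The integration interval includes `π`, where `h` says nothing; it is a null set.
    · have hpi : ∀ᵐ x : ℝ, x ≠ Real.pi := by simp [MeasureTheory.ae_iff]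
      filter_upwards [hpi] with x hx hmem
      rw [Set.uIoc_of_le Real.pi_pos.le] at hmem
      rw [← h x ⟨hmem.1, lt_of_le_of_ne hmem.2 hx⟩]
      have hs : Summable fun n : ℕ => b n * Real.cos ((n + 1) * x) :=
        hb.abs.of_norm_bounded fun n => by
          rw [norm_mul]
          exact mul_le_of_le_one_right (abs_nonneg _) (Real.abs_cos_le_one _)
      have hsum := hs.hasSum.mul_right (Real.cos (((m + 2 : ℕ) : ℝ) * x))
      simp_rw [mul_assoc (b _)] at hsum
      exact_mod_cast hsum
  have hzero : ∫ x in (0 : ℝ)..Real.pi,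
      (A + D * Real.cos x) * Real.cos (((m + 2 : ℕ) : ℝ) * x) = 0 := by
    have e : ∀ x : ℝ, (A + D * Real.cos x) * Real.cos (((m + 2 : ℕ) : ℝ) * x) =
        A * (Real.cos (((0 : ℕ) : ℝ) * x) * Real.cos (((m + 2 : ℕ) : ℝ) * x)) +
        D * (Real.cos (((1 : ℕ) : ℝ) * x) * Real.cos (((m + 2 : ℕ) : ℝ) * x)) := fun x => by
      simp only [Nat.cast_zero, Nat.cast_one, zero_mul, one_mul, Real.cos_zero]
      ring
    simp_rw [e]
    rw [intervalIntegral.integral_add (Continuous.intervalIntegrable (by fun_prop) _ _)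
      (Continuous.intervalIntegrable (by fun_prop) _ _), intervalIntegral.integral_const_mul,
      intervalIntegral.integral_const_mul, integral_cos_mul_cos _ _ (by omega),
      integral_cos_mul_cos _ _ (by omega)]
    simp
  simp_rw [intervalIntegral.integral_const_mul] at hsum
  rw [hzero] at hsum
  have hone := hasSum_single (f := fun n : ℕ => b n * ∫ x in (0 : ℝ)..Real.pi,
      (Real.cos (((n + 1 : ℕ) : ℝ) * x) * Real.cos (((m + 2 : ℕ) : ℝ) * x))) (m + 1)
    (fun n hn => by rw [integral_cos_mul_cos _ _ (by omega), mul_zero])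
  exact (mul_eq_zero.1 (hone.unique hsum)).resolve_right (integral_cos_sq_pos (m + 2)).ne'

/-- The cosine series of a strictly decreasing null sequence with summable weighted second
differences is not constant on `(0, π)`. -/
theorem secondDiffSeries_div_not_const {a : ℕ → ℝ} (ha : Filter.Tendsto a Filter.atTop (𝓝 0))
    (hanti : StrictAnti a) (hs : Summable fun n : ℕ => (n + 1) * |negSecondDiff a n|) (K : ℝ)
    (hK : ∀ x ∈ Set.Ioo 0 Real.pi, secondDiffSeries a x / (2 - 2 * Real.cos x) = K) : False := by
  have hb : Summable (negSecondDiff a) := by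
    simpa using summable_negSecondDiff_mul_cos hs (fun _ => 1) (by simp)
  -- Solving `secondDiffSeries a x = K (2 - 2 cos x)` for the sum gives `A` and `D`.
  have hcoeff := coeff_eq_zero_of_tsum_cos_eq hb (A := K - (a 0 - a 1)) (D := -K) fun x hx => by
    have hcos : Real.cos x < 1 := by
      simpa using Real.cos_lt_cos_of_nonneg_of_le_pi le_rfl hx.2.le hx.1
    have := hK x hx
    rw [div_eq_iff (by linarith)] at this
    rw [secondDiffSeries] at this
    linarith
  have hconst : ∀ m : ℕ, a (m + 1) - a (m + 2) = a 1 - a 2 := by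
    intro m
    induction m with
    | zero => rfl
    | succ m ih =>
      have := hcoeff m
      simp only [negSecondDiff] at this
      linarith [ih]
  have hlim : Filter.Tendsto (fun m : ℕ => a (m + 1) - a (m + 2)) Filter.atTop (𝓝 (0 - 0)) :=
    ((Filter.tendsto_add_atTop_iff_nat 1).2 ha).sub ((Filter.tendsto_add_atTop_iff_nat 2).2 ha)
  simp_rw [hconst] at hlim
  have := tendsto_nhds_unique hlim tendsto_const_nhds
  linarith [hanti (show 1 < 2 by norm_num)]

/-! ### Decay of the second differences of the symbol. -/

/-- The Fourier symbol `1 / (c + t^α)`. -/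
noncomputable def greenSymbol (α c t : ℝ) : ℝ := 1 / (c + t ^ α)

section
variable {α c : ℝ}

theorem hasDerivAt_greenSymbol (hc : 0 < c) {t : ℝ} (ht : 0 < t) :
    HasDerivAt (greenSymbol α c) (-(α * t ^ (α - 1)) / (c + t ^ α) ^ 2) t := by
  have hpos : 0 < c + t ^ α := add_pos hc (Real.rpow_pos_of_pos ht α)
  have h := ((Real.hasDerivAt_rpow_const (p := α) (Or.inl ht.ne')).const_add c).inv hpos.ne'
  have e : greenSymbol α c = (fun x => c + x ^ α)⁻¹ := by
    ext x
    simp [greenSymbol]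
  rwa [e]

theorem hasDerivAt_deriv_greenSymbol (hc : 0 < c) {t : ℝ} (ht : 0 < t) :
    HasDerivAt (fun t => -(α * t ^ (α - 1)) / (c + t ^ α) ^ 2)
      (-(α * (α - 1) * t ^ (α - 2)) / (c + t ^ α) ^ 2 +
        2 * α ^ 2 * (t ^ (α - 1)) ^ 2 / (c + t ^ α) ^ 3) t := by
  have hpos : 0 < c + t ^ α := add_pos hc (Real.rpow_pos_of_pos ht α)
  have h1 := (Real.hasDerivAt_rpow_const (x := t) (p := α) (Or.inl ht.ne')).const_add c
  have h2 := ((Real.hasDerivAt_rpow_const (x := t) (p := α - 1) (Or.inl ht.ne')).const_mul α).neg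
  refine (h2.div (h1.pow 2) (pow_ne_zero 2 hpos.ne')).congr_deriv ?_
  rw [show α - 1 - 1 = α - 2 by ring]
  simp only [Pi.pow_apply, Pi.neg_apply]
  field_simp
  push_cast
  ring

/-- Replacing `c + t^α` by the smaller `t^α` turns both terms into the same power, as `(α-2) - 2α =
2(α-1) - 3α = -α-2`. -/
theorem abs_deriv2_greenSymbol_le (hc : 0 < c) {t : ℝ} (ht : 0 < t) :
    |-(α * (α - 1) * t ^ (α - 2)) / (c + t ^ α) ^ 2 +
        2 * α ^ 2 * (t ^ (α - 1)) ^ 2 / (c + t ^ α) ^ 3| ≤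
      (|α * (α - 1)| + 2 * α ^ 2) * t ^ (-α - 2) := by
  have hp : 0 < t ^ α := Real.rpow_pos_of_pos ht α
  have e1 : t ^ (α - 2) / (t ^ α) ^ 2 = t ^ (-α - 2) := by
    rw [← Real.rpow_natCast, ← Real.rpow_mul ht.le, ← Real.rpow_sub ht]
    congr 1
    push_cast
    ring
  have e2 : (t ^ (α - 1)) ^ 2 / (t ^ α) ^ 3 = t ^ (-α - 2) := by
    rw [← Real.rpow_natCast, ← Real.rpow_natCast, ← Real.rpow_mul ht.le, ← Real.rpow_mul ht.le,
      ← Real.rpow_sub ht]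
    congr 1
    push_cast
    ring
  have hle : t ^ α ≤ c + t ^ α := by linarith
  have b1 : t ^ (α - 2) / (c + t ^ α) ^ 2 ≤ t ^ (-α - 2) := by
    rw [← e1]
    gcongr
  have b2 : (t ^ (α - 1)) ^ 2 / (c + t ^ α) ^ 3 ≤ t ^ (-α - 2) := by
    rw [← e2]
    gcongr
  refine (abs_add_le _ _).trans ?_
  rw [add_mul]
  refine add_le_add ?_ ?_
  · rw [neg_div, abs_neg, mul_div_assoc, abs_mul,
      abs_of_nonneg (by positivity : 0 ≤ t ^ (α - 2) / (c + t ^ α) ^ 2)]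
    gcongr
  · rw [mul_div_assoc, abs_of_nonneg (by positivity)]
    gcongr

/-- The second difference of the symbol is bounded by its second derivative. -/
theorem abs_negSecondDiff_greenSymbol_le (hα : 0 < α) (hc : 0 < c) {n : ℕ} (hn : 1 ≤ n) :
    |negSecondDiff (fun n => greenSymbol α c n) n| ≤
      (|α * (α - 1)| + 2 * α ^ 2) * (n : ℝ) ^ (-α - 2) := by
  set C := (|α * (α - 1)| + 2 * α ^ 2) * (n : ℝ) ^ (-α - 2) with hC
  have hn0 : (0 : ℝ) < n := by exact_mod_cast hn
  have hbound : ∀ t : ℝ, n ≤ t → ∀ s ∈ Set.Icc t (t + 1),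
      |-(α * (α - 1) * s ^ (α - 2)) / (c + s ^ α) ^ 2 +
        2 * α ^ 2 * (s ^ (α - 1)) ^ 2 / (c + s ^ α) ^ 3| ≤ C := fun t ht s hs => by
    refine (abs_deriv2_greenSymbol_le hc (hn0.trans_le (ht.trans hs.1))).trans ?_
    exact mul_le_mul_of_nonneg_left
      (Real.rpow_le_rpow_of_nonpos hn0 (ht.trans hs.1) (by linarith)) (by positivity)
  -- The mean value inequality is used twice: here for the unit increment of the derivative, then
  -- for the unit increment of `t ↦ g (t + 1) - g t`, with `g` the symbol.
  have hfirst : ∀ t : ℝ, n ≤ t → |-(α * (t + 1) ^ (α - 1)) / (c + (t + 1) ^ α) ^ 2 -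
      -(α * t ^ (α - 1)) / (c + t ^ α) ^ 2| ≤ C := fun t ht => by
    have := (convex_Icc t (t + 1)).norm_image_sub_le_of_norm_hasDerivWithin_le
      (f := fun t => -(α * t ^ (α - 1)) / (c + t ^ α) ^ 2)
      (fun s hs => (hasDerivAt_deriv_greenSymbol hc
        (hn0.trans_le (ht.trans hs.1))).hasDerivWithinAt) (hbound t ht)
      (Set.left_mem_Icc.2 (by linarith)) (Set.right_mem_Icc.2 (by linarith))
    simpa using this
  have := (convex_Icc (n : ℝ) (n + 1)).norm_image_sub_le_of_norm_hasDerivWithin_le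
    (f := fun t => greenSymbol α c (t + 1) - greenSymbol α c t)
    (fun s hs => (((hasDerivAt_greenSymbol hc (t := s + 1)
      (by linarith [hs.1])).comp_add_const s 1).sub
        (hasDerivAt_greenSymbol hc (hn0.trans_le hs.1))).hasDerivWithinAt)
    (fun s hs => hfirst s hs.1)
    (Set.left_mem_Icc.2 (by linarith)) (Set.right_mem_Icc.2 (by linarith))
  simp only [add_sub_cancel_left, norm_one, mul_one] at this
  rw [Real.norm_eq_abs, abs_sub_comm] at this
  convert this using 2
  simp only [negSecondDiff]
  push_cast
  rw [show (n : ℝ) + 1 + 1 = n + 2 by ring]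
  ring

theorem summable_negSecondDiff_greenSymbol (hα : 0 < α) (hc : 0 < c) :
    Summable fun n : ℕ => (n + 1) * |negSecondDiff (fun n => greenSymbol α c n) n| := by
  have hs : Summable fun n : ℕ =>
      2 * (|α * (α - 1)| + 2 * α ^ 2) * (n : ℝ) ^ (-α - 1) :=
    (Real.summable_nat_rpow.2 (by linarith)).mul_left _
  refine hs.of_norm_bounded_eventually_nat ?_
  filter_upwards [Filter.eventually_ge_atTop 1] with n hn
  have hn1 : (1 : ℝ) ≤ n := by exact_mod_cast hn
  have e : (n : ℝ) ^ (-α - 1) = n * (n : ℝ) ^ (-α - 2) := by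
    rw [show -α - 1 = 1 + (-α - 2) by ring, Real.rpow_add (by linarith), Real.rpow_one]
  rw [norm_mul, Real.norm_eq_abs, Real.norm_eq_abs, abs_abs, abs_of_nonneg (by positivity), e]
  calc ((n : ℝ) + 1) * |negSecondDiff (fun n => greenSymbol α c n) n|
      ≤ (2 * n) * ((|α * (α - 1)| + 2 * α ^ 2) * (n : ℝ) ^ (-α - 2)) := by
        gcongr
        · linarith
        · exact abs_negSecondDiff_greenSymbol_le hα hc hn
    _ = _ := by ring

theorem strictAnti_greenSymbol (hα : 0 < α) (hc : 0 < c) :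
    StrictAnti fun n : ℕ => greenSymbol α c n := by
  intro m n hmn
  have h := Real.rpow_lt_rpow m.cast_nonneg (Nat.cast_lt.2 hmn) hα
  have := Real.rpow_nonneg (m.cast_nonneg : (0 : ℝ) ≤ m) α
  exact one_div_lt_one_div_of_lt (by linarith) (by linarith)

theorem tendsto_greenSymbol (hα : 0 < α) :
    Filter.Tendsto (fun n : ℕ => greenSymbol α c n) Filter.atTop (𝓝 0) := by
  simp only [greenSymbol, one_div]
  exact (Filter.tendsto_atTop_add_const_left _ c
    ((tendsto_rpow_atTop hα).comp tendsto_natCast_atTop_atTop)).inv_tendsto_atTop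

/-! ### The Green function and the conclusion. -/

theorem sum_Icc_periodicGreenTerm (x : ℝ) (N : ℕ) :
    ∑ n ∈ Finset.Icc (-(N : ℤ)) N, periodicGreenTerm α c x n =
      greenSymbol α c (0 : ℕ) +
        2 * ∑ n ∈ Finset.range N, greenSymbol α c ((n + 1 : ℕ) : ℝ) * Real.cos ((n + 1) * x) := by
  induction N with
  | zero => simp [periodicGreenTerm, greenSymbol]
  | succ N ih =>
    have hN : |(N : ℝ) + 1| = N + 1 := abs_of_nonneg (by positivity)
    have hN' : |-1 + -(N : ℝ)| = N + 1 := by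
      rw [show -1 + -(N : ℝ) = -(N + 1) by ring, abs_neg, hN]
    have hcos : Real.cos ((-1 + -(N : ℝ)) * x) = Real.cos ((N + 1) * x) := by
      rw [← Real.cos_neg]
      ring_nf
    rw [show (-((N + 1 : ℕ) : ℤ)) = -((N : ℤ) + 1) by push_cast; rfl,
      show ((N + 1 : ℕ) : ℤ) = (N : ℤ) + 1 by push_cast; rfl, Finset.Icc_succ_succ, Finset.sum_union (by simp), ih, Finset.sum_range_succ,
      Finset.sum_pair (by omega)]
    simp only [periodicGreenTerm, greenSymbol]
    push_cast
    simp only [neg_add_rev, hN, hN', hcos]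
    ring

theorem hasSum_periodicGreenTerm (hα : 0 < α) (hc : 0 < c) {x : ℝ}
    (hx : x ∈ Set.Ioo 0 Real.pi) :
    HasSum (periodicGreenTerm α c x)
      (secondDiffSeries (fun n => greenSymbol α c n) x / (2 - 2 * Real.cos x))
      (SummationFilter.symmetricIcc ℤ) := by
  have hcos : Real.cos x < 1 := by
    simpa using Real.cos_lt_cos_of_nonneg_of_le_pi le_rfl hx.2.le hx.1
  rw [SummationFilter.hasSum_symmetricIcc_iff]
  simp_rw [sum_Icc_periodicGreenTerm]
  exact tendsto_cosSum (tendsto_greenSymbol hα) (summable_negSecondDiff_greenSymbol hα hc) hcos.ne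

theorem periodicGreen_eq (hα : 0 < α) (hc : 0 < c) {x : ℝ} (hx : x ∈ Set.Ioo 0 Real.pi) :
    periodicGreen α c x = 1 / (2 * Real.pi) *
      (secondDiffSeries (fun n => greenSymbol α c n) x / (2 - 2 * Real.cos x)) := by
  rw [periodicGreen, (hasSum_periodicGreenTerm hα hc hx).tsum_eq]

theorem differentiableOn_periodicGreen (hα : 0 < α) (hc : 0 < c) :
    DifferentiableOn ℝ (periodicGreen α c) (Set.Ioo 0 Real.pi) := by
  refine DifferentiableOn.congr (fun x hx => ?_) fun x hx => periodicGreen_eq hα hc hx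
  have hcos : Real.cos x < 1 := by
    simpa using Real.cos_lt_cos_of_nonneg_of_le_pi le_rfl hx.2.le hx.1
  exact ((hasDerivAt_secondDiffSeries_div (summable_negSecondDiff_greenSymbol hα hc)
    hcos.ne).const_mul _).differentiableAt.differentiableWithinAt

theorem tendsto_deriv_periodicGreen (hα : 0 < α) (hc : 0 < c) :
    Filter.Tendsto (deriv (periodicGreen α c)) (𝓝[<] Real.pi) (𝓝 0) := by
  have h := ((tendsto_deriv_secondDiffSeries_div
    (summable_negSecondDiff_greenSymbol hα hc)).const_mul (1 / (2 * Real.pi))).mono_left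
      (nhdsWithin_le_nhds (s := Set.Iio Real.pi))
  rw [mul_zero] at h
  refine h.congr' ?_
  filter_upwards [Ioo_mem_nhdsLT Real.pi_pos] with x hx
  have hev : periodicGreen α c =ᶠ[𝓝 x] fun x => 1 / (2 * Real.pi) *
      (secondDiffSeries (fun n => greenSymbol α c n) x / (2 - 2 * Real.cos x)) :=
    Filter.eventually_of_mem (isOpen_Ioo.mem_nhds hx) fun y hy => periodicGreen_eq hα hc hy
  rw [hev.deriv_eq, deriv_const_mul_field]

theorem periodicGreen_not_const (hα : 0 < α) (hc : 0 < c) (K : ℝ)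
    (hK : ∀ x ∈ Set.Ioo 0 Real.pi, periodicGreen α c x = K) : False := by
  refine secondDiffSeries_div_not_const (tendsto_greenSymbol hα) (strictAnti_greenSymbol hα hc)
    (summable_negSecondDiff_greenSymbol hα hc) (2 * Real.pi * K) fun x hx => ?_
  have hpi := Real.pi_pos
  rw [← hK x hx, periodicGreen_eq hα hc hx]
  field_simp

end

theorem not_completelyMonotone_extension {α c : ℝ} (hα : 0 < α) (hc : 0 < c) {F : ℝ → ℝ}
    (hF : CompletelyMonotoneOn F (Set.Ioi 0))
    (heq : Set.EqOn F (periodicGreen α c) (Set.Ioo 0 Real.pi)) : False := by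
  have hlim : Filter.Tendsto (deriv F) (𝓝[<] Real.pi) (𝓝 0) := by
    refine (tendsto_deriv_periodicGreen hα hc).congr' ?_
    filter_upwards [Ioo_mem_nhdsLT Real.pi_pos] with x hx
    exact (heq.symm.eventuallyEq_of_mem (isOpen_Ioo.mem_nhds hx)).deriv_eq
  refine periodicGreen_not_const hα hc (F 1) fun x hx => ?_
  rw [← heq hx]
  exact hF.eq_of_tendsto_deriv Real.pi_pos hlim hx.1 one_pos

theorem mainTheorem3 (α c : ℝ) (hα : α ∈ Set.Ioc (0 : ℝ) 2) (hc : 0 < c) :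
    -- the series converges on `(0, π)`, its sum is differentiable there, and `G'(π-) = 0`
    ((∀ x ∈ Set.Ioo (0 : ℝ) Real.pi,
        Summable (periodicGreenTerm α c x) (SummationFilter.symmetricIcc ℤ)) ∧
      DifferentiableOn ℝ (periodicGreen α c) (Set.Ioo 0 Real.pi) ∧
      Filter.Tendsto (deriv (periodicGreen α c)) (𝓝[<] Real.pi) (𝓝 0)) ∧
    -- no positive Radon measure on `[0, ∞)` represents `G` on `(0, π)`
    (¬ ∃ μ : MeasureTheory.Measure ℝ≥0, MeasureTheory.IsLocallyFiniteMeasure μ ∧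
        ∀ x ∈ Set.Ioo (0 : ℝ) Real.pi,
          MeasureTheory.Integrable (fun t : ℝ≥0 => Real.exp (-(x * (t : ℝ)))) μ ∧
          periodicGreen α c x = ∫ t : ℝ≥0, Real.exp (-(x * (t : ℝ))) ∂μ) ∧
    -- `G` has no completely monotone extension to `(0, ∞)`
    (¬ ∃ F : ℝ → ℝ, CompletelyMonotoneOn F (Set.Ioi 0) ∧
        Set.EqOn F (periodicGreen α c) (Set.Ioo 0 Real.pi)) := by
  refine ⟨⟨fun x hx => (hasSum_periodicGreenTerm hα.1 hc hx).summable,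
    differentiableOn_periodicGreen hα.1 hc, tendsto_deriv_periodicGreen hα.1 hc⟩, ?_, ?_⟩
  · rintro ⟨μ, -, hμ⟩
    refine not_completelyMonotone_extension hα.1 hc
      (completelyMonotoneOn_laplace μ fun x hx => ?_) fun x hx => (hμ x hx).2.symm
    -- Integrability is given only on `(0, π)`; it passes to every `x > 0` by comparison with some
    -- `y < min x π`, since `t ≥ 0`.
    obtain ⟨y, hy0, hy⟩ := exists_between (lt_min hx Real.pi_pos)
    refine (hμ y ⟨hy0, hy.trans_le (min_le_right _ _)⟩).1.mono'
      (Continuous.aestronglyMeasurable (by fun_prop)) (.of_forall fun t => ?_)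
    rw [Real.norm_eq_abs, Real.abs_exp, Real.exp_le_exp, neg_le_neg_iff]
    exact mul_le_mul_of_nonneg_right (hy.trans_le (min_le_left _ _)).le t.2
  · rintro ⟨F, hF, heq⟩
    exact not_completelyMonotone_extension hα.1 hc hF heq
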